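/- All vector spaces are over $\mathbb C$. A Möbius vertex algebra is a $\mathbb Z$-graded vector space $V=\coprod_{n\in\mathbb Z}V_n$ with a linear map $Y:V\to \mathrm{End}(V)[[x,x^{-1}]]$, $Y(v,x)=\sum_{n\in\mathbb Z}v_nx^{-n-1}$, a vacuum vector $\mathbf 1\in V_0$, and a representation of $\mathfrak{sl}(2)$ on $V$ by operators $L(-1),L(0),L(1)$ with $[L(0),L(-1)]=L(-1)$, $[L(0),L(1)]=-L(1)$, $[L(-1),L(1)]=-2L(0)$, such that for all $u,v\in V$: $u_nv=0$ for $n$ sufficiently large; $Y(\mathbf 1,x)=1_V$; $Y(v,x)\mathbf 1\in V[[x]]$ with constant term $v$; the Jacobi identity $$x_0^{-1}\delta\!\left(\tfrac{x_1-x_2}{x_0}\right)Y(u,x_1)Y(v,x_2)-x_0^{-1}\delta\!\left(\tfrac{x_2-x_1}{-x_0}\right)Y(v,x_2)Y(u,x_1)=x_2^{-1}\delta\!\left(\tfrac{x_1-x_0}{x_2}\right)Y(Y(u,x_0)v,x_2)$$ holds; $[L(j),Y(v,x)]=\sum_{k=0}^{j+1}\binom{j+1}{k}x^{j+1-k}Y(L(k-1)v,x)$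 for $j=-1,0,1$; $\frac{d}{dx}Y(v,x)=Y(L(-1)v,x)$; and $L(0)v=nv$ for $v\in V_n$. It is $\mathbb N$-graded if $V_n=0$ for all $n<0$. A quasimodule for $V$ is a vector space $W$ with a linear map $Y_W:V\to\mathrm{End}(W)[[x,x^{-1}]]$, $Y_W(v,x)=\sum_{n\in\mathbb Z}v_nx^{-n-1}$, and a representation of $\mathfrak{sl}(2)$ on $W$ by operators $L_W(-1),L_W(0),L_W(1)$ (satisfying the same bracket relations), such that for all $v\in V$, $w\in W$: $v_nw=0$ for $n$ sufficiently large; $Y_W(\mathbf 1,x)=1_W$; for all $u,v\in V$ there is a nonzero polynomial $f(x_1,x_2)\in\mathbb C[x_1,x_2]$ with $$x_0^{-1}\delta\!\left(\tfrac{x_1-x_2}{x_0}\right)f(x_1,x_2)Y_W(u,x_1)Y_W(v,x_2)-x_0^{-1}\delta\!\left(\tfrac{x_2-x_1}{-x_0}\right)f(x_1,x_2)Y_W(v,x_2)Y_W(u,x_1)=x_2^{-1}\delta\!\left(\tfrac{x_1-x_0}{x_2}\right)f(x_1,x_2)Y_W(Y(u,x_0)v,x_2);$$ $[L_W(j),Y_W(v,x)]=\sum_{k=0}^{j+1}\binom{j+1}{k}x^{j+1-k}Y_W(L(k-1)v,x)$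 for $j=-1,0,1$; and $\frac{d}{dx}Y_W(v,x)=Y_W(L(-1)v,x)$. For $n\ge 2$ put $C_n(W)=\mathrm{span}\{v_{-n}w: v\in V,\ w\in W\}$; $W$ is $C_n$-cofinite if $W/C_n(W)$ is finite-dimensional, and $V$ is $C_n$-cofinite if $V/C_n(V)$ is finite-dimensional, where $C_n(V)=\mathrm{span}\{u_{-n}v:u,v\in V\}$. Corollary. Let $V$ be a $C_2$-cofinite $\mathbb N$-graded Möbius vertex algebra and let $W$ be a quasimodule for $V$ (not assumed finitely generated). Then for every $n\ge 2$, $W$ is $C_2$-cofinite if and only if $W$ is $C_n$-cofinite. -/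

import Mathlib

/-- A representation of `𝔰𝔩(2)` on `W`, given by the operators `L(-1), L(0), L(1)` through which the
basis `L₋₁, L₀, L₁` of `𝔰𝔩(2)` acts. -/
structure Sl2Rep (W : Type*) [AddCommGroup W] [Module ℂ W] where
  /-- the operator `L(-1)` -/
  Lneg : Module.End ℂ W
  /-- the operator `L(0)` -/
  Lzero : Module.End ℂ W
  /-- the operator `L(1)` -/
  Lpos : Module.End ℂ W
  lie_zero_neg : ⁅Lzero, Lneg⁆ = Lneg
  lie_zero_pos : ⁅Lzero, Lpos⁆ = -Lpos
  lie_neg_pos : ⁅Lneg, Lpos⁆ = (-2 : ℂ) • Lzero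

section Modes

variable {V W : Type*} [AddCommGroup V] [Module ℂ V] [AddCommGroup W] [Module ℂ W]

/-- The mode `vₙ ∈ End W`, where `Y(v, x) = ∑ₙ vₙ x^{-n-1}`.  A `VertexOperator ℂ W` is a linear map
`W → W((x))`, so `vₙ w = 0` for `n` sufficiently large is part of the type. -/
noncomputable def vmode (Y : V →ₗ[ℂ] VertexOperator ℂ W) (v : V) (n : ℤ) : Module.End ℂ W :=
  VertexOperator.ncoeff (Y v) n

/-- The coefficient of `x₀^{-l-1} x₁^{-m-1} x₂^{-n-1}` in
`x₀⁻¹ δ((x₁ - x₂)/x₀) Y(u,x₁) Y(v,x₂) w`, where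
`x₀⁻¹ δ((x₁ - x₂)/x₀) = ∑ₗ x₀^{-l-1} (x₁ - x₂)^l` and
`(x₁ - x₂)^l = ∑_{i ≥ 0} (-1)^i (l choose i) x₁^{l-i} x₂^i`.  Only finitely many terms are nonzero. -/
noncomputable def jacobiFirst (Y : V →ₗ[ℂ] VertexOperator ℂ W) (u v : V) (l m n : ℤ) (w : W) : W :=
  ∑ᶠ i : ℕ, ((-1 : ℂ) ^ i * (Ring.choose l i : ℂ)) •
    vmode Y u (m + l - i) (vmode Y v (n + i) w)

/-- The coefficient of `x₀^{-l-1} x₁^{-m-1} x₂^{-n-1}` in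
`x₀⁻¹ δ((x₂ - x₁)/(-x₀)) Y(v,x₂) Y(u,x₁) w`, where
`x₀⁻¹ δ((x₂ - x₁)/(-x₀)) = ∑ₗ (-1)^l x₀^{-l-1} (x₂ - x₁)^l` and
`(x₂ - x₁)^l = ∑_{i ≥ 0} (-1)^i (l choose i) x₂^{l-i} x₁^i`.  Only finitely many terms are nonzero. -/
noncomputable def jacobiSecond (Y : V →ₗ[ℂ] VertexOperator ℂ W) (u v : V) (l m n : ℤ) (w : W) : W :=
  ∑ᶠ i : ℕ, ((-1 : ℂ) ^ l * (-1 : ℂ) ^ i * (Ring.choose l i : ℂ)) •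
    vmode Y v (n + l - i) (vmode Y u (m + i) w)

/-- The coefficient of `x₀^{-l-1} x₁^{-m-1} x₂^{-n-1}` in
`x₂⁻¹ δ((x₁ - x₀)/x₂) Y_W(Y(u,x₀)v, x₂) w`, where
`x₂⁻¹ δ((x₁ - x₀)/x₂) = ∑ₚ x₂^{-p-1} (x₁ - x₀)^p`, expanded in nonnegative powers of `x₀`, equals
`∑_{m ∈ ℤ} ∑_{i ≥ 0} (m choose i) x₀^i x₁^{-m-1} x₂^{m-i}`.  Only finitely many terms are nonzero. -/
noncomputable def jacobiThird (Y : V →ₗ[ℂ] VertexOperator ℂ V) (YW : V →ₗ[ℂ] VertexOperator ℂ W)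
    (u v : V) (l m n : ℤ) (w : W) : W :=
  ∑ᶠ i : ℕ, (Ring.choose m i : ℂ) • vmode YW (vmode Y u (l + i) v) (m + n - i) w

/-- Multiplication of a formal distribution by the polynomial `f(x₁, x₂) = ∑ a_{ij} x₁^i x₂^j`, where
`F m n` is the coefficient of `x₁^{-m-1} x₂^{-n-1}`. -/
noncomputable def polyMulDist (f : MvPolynomial (Fin 2) ℂ) (F : ℤ → ℤ → W) (m n : ℤ) : W :=
  ∑ d ∈ f.support, f.coeff d • F (m + (d 0 : ℕ)) (n + (d 1 : ℕ))

/-- The Jacobi identity for `u, v`, coefficient by coefficient. -/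
def JacobiIdentity (Y : V →ₗ[ℂ] VertexOperator ℂ V) (u v : V) : Prop :=
  ∀ (l m n : ℤ) (w : V),
    jacobiFirst Y u v l m n w - jacobiSecond Y u v l m n w = jacobiThird Y Y u v l m n w

/-- The quasi-Jacobi identity for `u, v` with the polynomial `f`: both sides of the Jacobi identity
are multiplied by `f(x₁, x₂)`. -/
def QuasiJacobiIdentity (Y : V →ₗ[ℂ] VertexOperator ℂ V) (YW : V →ₗ[ℂ] VertexOperator ℂ W)
    (f : MvPolynomial (Fin 2) ℂ) (u v : V) : Prop :=
  ∀ (l m n : ℤ) (w : W),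
    polyMulDist f (fun m n => jacobiFirst YW u v l m n w) m n
      - polyMulDist f (fun m n => jacobiSecond YW u v l m n w) m n
      = polyMulDist f (fun m n => jacobiThird Y YW u v l m n w) m n

/-- `Y_W(𝟏, x) = 1_W`. -/
def VacuumProperty (YW : V →ₗ[ℂ] VertexOperator ℂ W) (one : V) : Prop :=
  ∀ n : ℤ, vmode YW one n = if n = -1 then LinearMap.id else 0

/-- `[L_W(j), Y_W(v,x)] = ∑_{k=0}^{j+1} (j+1 choose k) x^{j+1-k} Y_W(L(k-1)v, x)` for `j = -1, 0, 1`,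
written as an identity between the coefficients of `x^{-n-1}`. -/
structure Sl2Compatible (L : Sl2Rep V) (LW : Sl2Rep W) (YW : V →ₗ[ℂ] VertexOperator ℂ W) : Prop where
  bracket_neg : ∀ (v : V) (n : ℤ), ⁅LW.Lneg, vmode YW v n⁆ = vmode YW (L.Lneg v) n
  bracket_zero : ∀ (v : V) (n : ℤ), ⁅LW.Lzero, vmode YW v n⁆ =
    vmode YW (L.Lneg v) (n + 1) + vmode YW (L.Lzero v) n
  bracket_pos : ∀ (v : V) (n : ℤ), ⁅LW.Lpos, vmode YW v n⁆ =
    vmode YW (L.Lneg v) (n + 2) + (2 : ℂ) • vmode YW (L.Lzero v) (n + 1) + vmode YW (L.Lpos v) n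

/-- `d/dx Y_W(v,x) = Y_W(L(-1)v, x)`, compared at `x^{-n-1}`. -/
def DerivativeProperty (L : Sl2Rep V) (YW : V →ₗ[ℂ] VertexOperator ℂ W) : Prop :=
  ∀ (v : V) (n : ℤ), vmode YW (L.Lneg v) n = (-(n : ℂ)) • vmode YW v (n - 1)

/-- `C_n(W) = span {v_{-n} w : v ∈ V, w ∈ W}`. -/
def cnSubspace (YW : V →ₗ[ℂ] VertexOperator ℂ W) (n : ℕ) : Submodule ℂ W :=
  Submodule.span ℂ {x | ∃ (v : V) (w : W), x = vmode YW v (-(n : ℤ)) w}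

end Modes

/-- A Möbius vertex algebra structure on the complex vector space `V`. -/
structure MobiusVertexAlgebra (V : Type*) [AddCommGroup V] [Module ℂ V] where
  /-- the homogeneous subspaces `V_n` -/
  grading : ℤ → Submodule ℂ V
  isInternal : DirectSum.IsInternal grading
  /-- the vertex operator map `v ↦ Y(v, x)` -/
  Y : V →ₗ[ℂ] VertexOperator ℂ V
  /-- the vacuum vector -/
  vacuum : V
  vacuum_mem : vacuum ∈ grading 0
  vacuum_property : VacuumProperty Y vacuum
  creation_nonneg : ∀ (v : V) (n : ℤ), 0 ≤ n → vmode Y v n vacuum = 0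
  creation : ∀ v : V, vmode Y v (-1) vacuum = v
  jacobi : ∀ u v : V, JacobiIdentity Y u v
  /-- the representation of `𝔰𝔩(2)` on `V` -/
  L : Sl2Rep V
  sl2_compatible : Sl2Compatible L L Y
  derivative : DerivativeProperty L Y
  weight : ∀ (n : ℤ), ∀ v ∈ grading n, L.Lzero v = (n : ℂ) • v

namespace MobiusVertexAlgebra

variable {V : Type*} [AddCommGroup V] [Module ℂ V]

/-- `V_n = 0` for `n < 0`. -/
def IsNGraded (A : MobiusVertexAlgebra V) : Prop :=
  ∀ n : ℤ, n < 0 → A.grading n = ⊥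

/-- `V` is `C_n`-cofinite: `V / C_n(V)` is finite-dimensional (used for `n ≥ 2`). -/
def IsCnCofinite (A : MobiusVertexAlgebra V) (n : ℕ) : Prop :=
  FiniteDimensional ℂ (V ⧸ cnSubspace A.Y n)

end MobiusVertexAlgebra

/-- A quasimodule structure on the complex vector space `W` for the Möbius vertex algebra `A`. -/
structure Quasimodule {V : Type*} [AddCommGroup V] [Module ℂ V] (A : MobiusVertexAlgebra V)
    (W : Type*) [AddCommGroup W] [Module ℂ W] where
  /-- the vertex operator map `v ↦ Y_W(v, x)` -/
  YW : V →ₗ[ℂ] VertexOperator ℂ W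
  vacuum_property : VacuumProperty YW A.vacuum
  quasi_jacobi : ∀ u v : V, ∃ f : MvPolynomial (Fin 2) ℂ, f ≠ 0 ∧ QuasiJacobiIdentity A.Y YW f u v
  /-- the representation of `𝔰𝔩(2)` on `W` -/
  LW : Sl2Rep W
  sl2_compatible : Sl2Compatible A.L LW YW
  derivative : DerivativeProperty A.L YW

namespace Quasimodule

variable {V : Type*} [AddCommGroup V] [Module ℂ V] {A : MobiusVertexAlgebra V}
  {W : Type*} [AddCommGroup W] [Module ℂ W]

/-- `W` is `C_n`-cofinite: `W / C_n(W)` is finite-dimensional (used for `n ≥ 2`). -/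
def IsCnCofinite (M : Quasimodule A W) (n : ℕ) : Prop :=
  FiniteDimensional ℂ (W ⧸ cnSubspace M.YW n)

end Quasimodule

/-! The argument has two halves. First, the `𝔰𝔩(2)`-action upgrades the quasi-Jacobi identity to the
full Jacobi identity (`Quasimodule.moduleJacobiIdentity`). For `u`, `v` homogeneous, let `J` be the
difference of the two sides. On `J`, multiplication by `x₁ - x₂` equals multiplication by the
invertible variable `x₀`; bracketing with `L(-1)` acts as `∂₁ + ∂₂`, and bracketing with `L(0)` acts
as an Euler operator. If a polynomial `f` kills `J`, the product rule shows that `∂₁f + ∂₂f` and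
`x₁∂₁f + x₂∂₂f` kill `J`, hence so does `(x₁ - x₂)∂₁f`. Cancelling `x₀` gives `∂₁f`, then `∂₂f`.
Differentiating a nonzero `f` repeatedly reaches a nonzero constant, so `J = 0`
(`eq_zero_of_polyMulDist_eq_zero`).

Second, for an honest module and `k ≥ 2`, `u_{-k} v_{-k} W ⊆ C_{k+1}(W)`
(`vmode_vmode_mem_cnSubspace_succ`). Hence, modulo `C_{k+1}(W)`, the vector `v_{-k} w` depends only
on `v` mod `C_k(V)` and `w` mod `C_k(W)`. If both quotients are finite-dimensional, so is
`C_k(W)/(C_k(W) ∩ C_{k+1}(W))`, and `C_k`-cofiniteness passes to `k + 1` (`cofinite_succ`). Taking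
`W = V` gives all `C_k`-cofiniteness of `V`; induction then handles `W`. The converse is `C_n(W) ⊆
C_2(W)`, which follows from the derivative property. -/

/-! ### Finite sums indexed by the natural numbers. -/

section FinsumNat

variable {W : Type*} [AddCommGroup W]

/-- A sequence that vanishes from some index on. -/
def EventuallyZero (x : ℕ → W) : Prop := ∃ N : ℕ, ∀ i, N ≤ i → x i = 0

theorem EventuallyZero.finite_support {x : ℕ → W} (hx : EventuallyZero x) :
    x.support.Finite := by
  obtain ⟨N, hN⟩ := hx
  refine (Finset.range N).finite_toSet.subset fun i hi => ?_
  by_contra h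
  exact hi (hN i (by simpa using h))

theorem EventuallyZero.succ {x : ℕ → W} (hx : EventuallyZero x) :
    EventuallyZero fun i => x (i + 1) := by
  obtain ⟨N, hN⟩ := hx
  exact ⟨N, fun i hi => hN _ (by omega)⟩

theorem EventuallyZero.add {x y : ℕ → W} (hx : EventuallyZero x) (hy : EventuallyZero y) :
    EventuallyZero fun i => x i + y i := by
  obtain ⟨N, hN⟩ := hx
  obtain ⟨K, hK⟩ := hy
  exact ⟨max N K, fun i hi => by
    simp [hN i (le_trans (le_max_left _ _) hi), hK i (le_trans (le_max_right _ _) hi)]⟩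

theorem EventuallyZero.finsum_eq {x : ℕ → W} {N : ℕ} (hN : ∀ i, N ≤ i → x i = 0) :
    ∑ᶠ i, x i = ∑ i ∈ Finset.range N, x i := by
  refine finsum_eq_sum_of_support_subset x fun i hi => ?_
  by_contra h
  exact hi (hN i (by simpa using h))

theorem finsum_add_of_eventuallyZero {x y : ℕ → W} (hx : EventuallyZero x)
    (hy : EventuallyZero y) : ∑ᶠ i, (x i + y i) = ∑ᶠ i, x i + ∑ᶠ i, y i :=
  finsum_add_distrib hx.finite_support hy.finite_support

variable [Module ℂ W]

theorem EventuallyZero.smul {x : ℕ → W} (hx : EventuallyZero x) (c : ℕ → ℂ) :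
    EventuallyZero fun i => c i • x i := by
  obtain ⟨N, hN⟩ := hx
  exact ⟨N, fun i hi => by simp [hN i hi]⟩

/-- Linear combinations with coefficients related by a Pascal-type recursion. -/
theorem finsum_smul_of_recursion {x : ℕ → W} (hx : EventuallyZero x) {a a' b : ℕ → ℂ}
    (h0 : b 0 = a 0) (hs : ∀ i, b (i + 1) = a (i + 1) + a' i) :
    ∑ᶠ i, b i • x i = ∑ᶠ i, a i • x i + ∑ᶠ i, a' i • x (i + 1) := by
  obtain ⟨N, hN⟩ := hx
  rw [EventuallyZero.finsum_eq (N := N + 1) fun i hi => by simp [hN i (by omega)],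
    EventuallyZero.finsum_eq (N := N + 1) fun i hi => by simp [hN i (by omega)],
    EventuallyZero.finsum_eq (N := N) fun i hi => by simp [hN (i + 1) (by omega)],
    Finset.sum_range_succ', Finset.sum_range_succ', h0, add_right_comm, ← Finset.sum_add_distrib]
  simp only [hs, add_smul]

theorem map_finsum_of_eventuallyZero {x : ℕ → W} (hx : EventuallyZero x) (T : Module.End ℂ W) :
    T (∑ᶠ i, x i) = ∑ᶠ i, T (x i) :=
  map_finsum T hx.finite_support

theorem finsum_mem_submodule (S : Submodule ℂ W) {x : ℕ → W} (h : ∀ i, x i ∈ S) :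
    ∑ᶠ i, x i ∈ S :=
  finsum_induction (· ∈ S) S.zero_mem (fun _ _ => S.add_mem) h

end FinsumNat

/-! ### Binomial coefficient identities. -/

section Choose

theorem Ring.succ_mul_choose_succ (r : ℂ) (i : ℕ) :
    ((i : ℂ) + 1) * Ring.choose r (i + 1) = (r - i) * Ring.choose r i := by
  have h := Ring.choose_smul_choose r (n := i + 1) (k := i) (by omega)
  rw [Nat.choose_succ_self_right, show i + 1 - i = 1 by omega, Ring.choose_one_right] at h
  push_cast [nsmul_eq_mul] at h
  rw [h]
  ring

theorem Ring.mul_choose_pred (r : ℂ) (i : ℕ) :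
    r * Ring.choose (r - 1) i = (r - i) * Ring.choose r i := by
  cases i with
  | zero => simp
  | succ i =>
    have h1 := Ring.succ_mul_choose_succ (r - 1) i
    have h2 := Ring.choose_succ_succ (r - 1) i
    rw [sub_add_cancel] at h2
    rw [h2]
    push_cast
    linear_combination h1

end Choose

/-! ### Formal expansions of `(x₁ - x₂)^l` and of the delta function. -/

section Expansions

variable {W : Type*} [AddCommGroup W]

theorem eventuallyZero_of_right {A : ℤ → ℤ → W} (hA : ∃ N : ℤ, ∀ p q, N ≤ q → A p q = 0)
    (f : ℕ → ℤ) (n : ℤ) : EventuallyZero fun i : ℕ => A (f i) (n + i) := by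
  obtain ⟨N, hN⟩ := hA
  exact ⟨(N - n).toNat, fun i hi => hN _ _ (by omega)⟩

theorem eventuallyZero_of_left {C : ℤ → ℤ → W} (hC : ∃ N : ℤ, ∀ p q, N ≤ p → C p q = 0)
    (f : ℕ → ℤ) (l : ℤ) : EventuallyZero fun i : ℕ => C (l + i) (f i) := by
  obtain ⟨N, hN⟩ := hC
  exact ⟨(N - l).toNat, fun i hi => hN _ _ (by omega)⟩

variable [Module ℂ W]

/-- The coefficients of `(x₁ - x₂)^l ∑ A p q x₁^{-p-1} x₂^{-q-1}`, expanded in nonnegative powers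
of `x₂`. -/
noncomputable def productExpansion (A : ℤ → ℤ → W) (l m n : ℤ) : W :=
  ∑ᶠ i : ℕ, ((-1 : ℂ) ^ i * (Ring.choose l i : ℂ)) • A (m + l - i) (n + i)

/-- The coefficients of `x₂⁻¹ δ((x₁ - x₀)/x₂) ∑ C p q x₀^{-p-1} x₂^{-q-1}`. -/
noncomputable def iterateExpansion (C : ℤ → ℤ → W) (l m n : ℤ) : W :=
  ∑ᶠ i : ℕ, (Ring.choose m i : ℂ) • C (l + i) (m + n - i)

/-- Pascal's rule, i.e. `(x₁ - x₂)^{l+1} = (x₁ - x₂)(x₁ - x₂)^l`; multiplying by `x₁` or `x₂` raises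
`m` or `n`. -/
theorem productExpansion_succ {A : ℤ → ℤ → W} (hA : ∃ N : ℤ, ∀ p q, N ≤ q → A p q = 0)
    (l m n : ℤ) : productExpansion A (l + 1) m n =
      productExpansion A l (m + 1) n - productExpansion A l m (n + 1) := by
  have key := finsum_smul_of_recursion
    (eventuallyZero_of_right hA (fun i => m + (l + 1) - i) n)
    (b := fun i => (-1 : ℂ) ^ i * (Ring.choose (l + 1) i : ℂ))
    (a := fun i => (-1 : ℂ) ^ i * (Ring.choose l i : ℂ))
    (a' := fun i => -((-1 : ℂ) ^ i * (Ring.choose l i : ℂ)))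
    (by simp) (fun i => by rw [Ring.choose_succ_succ]; ring)
  rw [productExpansion, productExpansion, productExpansion, Int.cast_add, Int.cast_one, key, sub_eq_add_neg,
    ← finsum_neg_distrib]
  congr 1
  · refine finsum_congr fun i => ?_
    rw [show m + (l + 1) - (i : ℤ) = m + 1 + l - i by ring]
  · refine finsum_congr fun i => ?_
    rw [neg_smul]
    push_cast
    rw [show m + (l + 1) - ((i : ℤ) + 1) = m + l - i by ring,
      show n + ((i : ℤ) + 1) = n + 1 + i by ring]

/-- `∂₁ + ∂₂` kills `(x₁ - x₂)^l`, so it commutes with multiplication by it. -/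
theorem productExpansion_deriv {A : ℤ → ℤ → W} (hA : ∃ N : ℤ, ∀ p q, N ≤ q → A p q = 0)
    (l m n : ℤ) :
    productExpansion (fun p q => (-(p : ℂ)) • A (p - 1) q + (-(q : ℂ)) • A p (q - 1)) l m n =
      (-(m : ℂ)) • productExpansion A l (m - 1) n
        + (-(n : ℂ)) • productExpansion A l m (n - 1) := by
  have hx := eventuallyZero_of_right hA (fun i => m + l - i) (n - 1)
  -- The two contributions of differentiating `(x₁ - x₂)^l` are opposite, since `(i+1) (l choose
  -- i+1) = (l-i) (l choose i)`. In `e2` below they form the second pair of terms, which cancels.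
  have key := finsum_smul_of_recursion hx
    (b := fun i => (i : ℂ) * ((-1 : ℂ) ^ i * (Ring.choose l i : ℂ)))
    (a := fun _ => 0)
    (a' := fun i => -(((l : ℂ) - i) * ((-1 : ℂ) ^ i * (Ring.choose l i : ℂ))))
    (by simp) (fun i => by
      have := Ring.succ_mul_choose_succ (l : ℂ) i
      push_cast
      linear_combination (-1 : ℂ) ^ (i + 1) * this)
  simp only [zero_smul, finsum_zero, zero_add] at key
  have e1 : productExpansion A l (m - 1) n = ∑ᶠ i : ℕ, ((-1 : ℂ) ^ i * (Ring.choose l i : ℂ)) •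
      A (m + l - (i + 1 : ℕ)) (n - 1 + (i + 1 : ℕ)) := by
    refine finsum_congr fun i => ?_
    push_cast
    rw [show m + l - ((i : ℤ) + 1) = m - 1 + l - i by ring,
      show n - 1 + ((i : ℤ) + 1) = n + i by ring]
  have e2 : productExpansion (fun p q => (-(p : ℂ)) • A (p - 1) q + (-(q : ℂ)) • A p (q - 1)) l m n
      = ∑ᶠ i : ℕ, ((((-(m : ℂ)) * ((-1 : ℂ) ^ i * (Ring.choose l i : ℂ))) •
            A (m + l - (i + 1 : ℕ)) (n - 1 + (i + 1 : ℕ))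
          + ((-(n : ℂ)) * ((-1 : ℂ) ^ i * (Ring.choose l i : ℂ))) •
            A (m + l - (i : ℕ)) (n - 1 + (i : ℕ)))
          + ((-(((l : ℂ) - i) * ((-1 : ℂ) ^ i * (Ring.choose l i : ℂ)))) •
            A (m + l - (i + 1 : ℕ)) (n - 1 + (i + 1 : ℕ))
          + (-((i : ℂ) * ((-1 : ℂ) ^ i * (Ring.choose l i : ℂ)))) •
            A (m + l - (i : ℕ)) (n - 1 + (i : ℕ)))) := by
    refine finsum_congr fun i => ?_
    push_cast
    rw [show m + l - ((i : ℤ) + 1) = m + l - i - 1 by ring,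
      show n - 1 + ((i : ℤ) + 1) = n + i by ring, show n - 1 + (i : ℤ) = n + i - 1 by ring]
    module
  have hx' := hx.succ
  rw [e2, finsum_add_of_eventuallyZero ((hx'.smul _).add (hx.smul _))
      ((hx'.smul _).add (hx.smul _)),
    finsum_add_of_eventuallyZero (hx'.smul _) (hx.smul _),
    finsum_add_of_eventuallyZero (hx'.smul _) (hx.smul _), ← key, e1, productExpansion, smul_finsum, smul_finsum]
  simp only [neg_smul, finsum_neg_distrib, add_neg_cancel, add_zero, smul_smul, neg_mul]

/-- Pascal's rule again: on the delta function, `x₀` equals `x₁ - x₂`. -/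
theorem iterateExpansion_succ {C : ℤ → ℤ → W} (hC : ∃ N : ℤ, ∀ p q, N ≤ p → C p q = 0)
    (l m n : ℤ) : iterateExpansion C (l + 1) m n =
      iterateExpansion C l (m + 1) n - iterateExpansion C l m (n + 1) := by
  have key := finsum_smul_of_recursion
    (eventuallyZero_of_left hC (fun i => m + 1 + n - i) l)
    (b := fun i => (Ring.choose (m + 1) i : ℂ))
    (a := fun i => (Ring.choose m i : ℂ))
    (a' := fun i => (Ring.choose m i : ℂ))
    (by simp) (fun i => by rw [Ring.choose_succ_succ]; ring)
  rw [iterateExpansion, iterateExpansion, iterateExpansion, Int.cast_add, Int.cast_one, key, eq_sub_iff_add_eq, add_comm]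
  congr 1
  · refine finsum_congr fun i => ?_
    rw [show m + (n + 1) - (i : ℤ) = m + 1 + n - i by ring]
  · refine finsum_congr fun i => ?_
    push_cast
    rw [show m + 1 + n - ((i : ℤ) + 1) = m + n - i by ring,
      show l + ((i : ℤ) + 1) = l + 1 + i by ring]

/-- `∂₁ + ∂₂` kills `x₂⁻¹ δ((x₁ - x₀)/x₂)`, so it only differentiates the `x₂` in `C`. -/
theorem iterateExpansion_deriv {C : ℤ → ℤ → W} (hC : ∃ N : ℤ, ∀ p q, N ≤ p → C p q = 0)
    (l m n : ℤ) :
    iterateExpansion (fun p q => (-(q : ℂ)) • C p (q - 1)) l m n =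
      (-(m : ℂ)) • iterateExpansion C l (m - 1) n
        + (-(n : ℂ)) • iterateExpansion C l m (n - 1) := by
  simp only [iterateExpansion, smul_finsum, smul_smul]
  rw [← finsum_add_of_eventuallyZero
    ((eventuallyZero_of_left hC (fun i => m - 1 + n - i) l).smul _)
    ((eventuallyZero_of_left hC (fun i => m + (n - 1) - i) l).smul _)]
  refine finsum_congr fun i => ?_
  rw [show m - 1 + n - (i : ℤ) = m + n - i - 1 by ring,
    show m + (n - 1) - (i : ℤ) = m + n - i - 1 by ring, ← add_smul]
  congr 1
  have := Ring.mul_choose_pred (m : ℂ) i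
  push_cast
  linear_combination this

theorem productExpansion_add {A B : ℤ → ℤ → W} (hA : ∃ N : ℤ, ∀ p q, N ≤ q → A p q = 0)
    (hB : ∃ N : ℤ, ∀ p q, N ≤ q → B p q = 0) (l m n : ℤ) :
    productExpansion (fun p q => A p q + B p q) l m n =
      productExpansion A l m n + productExpansion B l m n := by
  simp only [productExpansion, smul_add]
  exact finsum_add_of_eventuallyZero ((eventuallyZero_of_right hA _ _).smul _)
    ((eventuallyZero_of_right hB _ _).smul _)

theorem iterateExpansion_add {A B : ℤ → ℤ → W} (hA : ∃ N : ℤ, ∀ p q, N ≤ p → A p q = 0)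
    (hB : ∃ N : ℤ, ∀ p q, N ≤ p → B p q = 0) (l m n : ℤ) :
    iterateExpansion (fun p q => A p q + B p q) l m n =
      iterateExpansion A l m n + iterateExpansion B l m n := by
  simp only [iterateExpansion, smul_add]
  exact finsum_add_of_eventuallyZero ((eventuallyZero_of_left hA _ _).smul _)
    ((eventuallyZero_of_left hB _ _).smul _)

theorem map_productExpansion {A : ℤ → ℤ → W} (hA : ∃ N : ℤ, ∀ p q, N ≤ q → A p q = 0)
    (T : Module.End ℂ W) (l m n : ℤ) :
    T (productExpansion A l m n) = productExpansion (fun p q => T (A p q)) l m n := by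
  simp only [productExpansion, ← map_smul]
  exact map_finsum_of_eventuallyZero ((eventuallyZero_of_right hA _ _).smul _) T

theorem map_iterateExpansion {C : ℤ → ℤ → W} (hC : ∃ N : ℤ, ∀ p q, N ≤ p → C p q = 0)
    (T : Module.End ℂ W) (l m n : ℤ) :
    T (iterateExpansion C l m n) = iterateExpansion (fun p q => T (C p q)) l m n := by
  simp only [iterateExpansion, ← map_smul]
  exact map_finsum_of_eventuallyZero ((eventuallyZero_of_left hC _ _).smul _) T

end Expansions

/-! ### Distributions annihilated by a nonzero polynomial. -/

section PolynomialAction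

open MvPolynomial

variable {E : Type*} [AddCommGroup E] [Module ℂ E]

/-- `polyMulDist` as a linear map in the polynomial. -/
noncomputable def polyAction (F : ℤ → ℤ → E) (m n : ℤ) : MvPolynomial (Fin 2) ℂ →ₗ[ℂ] E :=
  (basisMonomials (Fin 2) ℂ).constr ℂ fun d => F (m + (d 0 : ℕ)) (n + (d 1 : ℕ))

theorem polyAction_monomial (F : ℤ → ℤ → E) (m n : ℤ) (d : Fin 2 →₀ ℕ) (a : ℂ) :
    polyAction F m n (monomial d a) = a • F (m + (d 0 : ℕ)) (n + (d 1 : ℕ)) := by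
  have h : monomial d a = a • basisMonomials (Fin 2) ℂ d := by
    rw [coe_basisMonomials, smul_monomial, smul_eq_mul, mul_one]
  rw [h, map_smul, polyAction, Module.Basis.constr_basis]

theorem polyMulDist_eq_polyAction (f : MvPolynomial (Fin 2) ℂ) (F : ℤ → ℤ → E) (m n : ℤ) :
    polyMulDist f F m n = polyAction F m n f := by
  conv_rhs => rw [f.as_sum, map_sum]
  simp only [polyAction_monomial]
  rfl

theorem polyAction_X_zero_mul (F : ℤ → ℤ → E) (m n : ℤ) (f : MvPolynomial (Fin 2) ℂ) :
    polyAction F m n (X 0 * f) = polyAction F (m + 1) n f := by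
  induction f using MvPolynomial.induction_on' with
  | monomial d a =>
    rw [X, monomial_mul, polyAction_monomial, polyAction_monomial, one_mul]
    simp [add_assoc]
  | add p q hp hq => rw [mul_add, map_add, map_add, hp, hq]

theorem polyAction_X_one_mul (F : ℤ → ℤ → E) (m n : ℤ) (f : MvPolynomial (Fin 2) ℂ) :
    polyAction F m n (X 1 * f) = polyAction F m (n + 1) f := by
  induction f using MvPolynomial.induction_on' with
  | monomial d a =>
    rw [X, monomial_mul, polyAction_monomial, polyAction_monomial, one_mul]
    simp [add_assoc]
  | add p q hp hq => rw [mul_add, map_add, map_add, hp, hq]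

/-- In characteristic zero the coefficient `d i * coeff d f` survives differentiation; the drop in
degree drives the induction that reaches a constant. -/
theorem totalDegree_pderiv_lt {f : MvPolynomial (Fin 2) ℂ} {i : Fin 2} {d : Fin 2 →₀ ℕ}
    (hd : d ∈ f.support) (hi : d i ≠ 0) :
    pderiv i f ≠ 0 ∧ (pderiv i f).totalDegree < f.totalDegree := by
  have hsub : d - Finsupp.single i 1 + Finsupp.single i 1 = d :=
    tsub_add_cancel_of_le (by simpa [Nat.one_le_iff_ne_zero] using hi)
  constructor
  · intro h
    have hc := coeff_pderiv (i := i) f (d - Finsupp.single i 1)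
    rw [h, coeff_zero, hsub] at hc
    rcases mul_eq_zero.mp hc.symm with h | h
    · exact mem_support_iff.mp hd h
    · norm_cast at h
  · have hdeg : ∀ e ∈ (pderiv i f).support, (e.sum fun _ k => k) + 1 ≤ f.totalDegree := by
      intro e he
      have : e + Finsupp.single i 1 ∈ f.support := by
        rw [mem_support_iff, coeff_pderiv] at he
        exact mem_support_iff.mpr (left_ne_zero_of_mul he)
      have h := le_totalDegree this
      rwa [Finsupp.sum_add_index' (fun _ => rfl) (fun _ _ _ => rfl),
        Finsupp.sum_single_index rfl] at h
    have hpos : 0 < f.totalDegree := by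
      have h := le_totalDegree hd
      have h' : d i ≤ d.sum fun _ k => k :=
        Finset.single_le_sum (f := fun j => d j) (fun _ _ => Nat.zero_le _)
          (Finsupp.mem_support_iff.mpr hi)
      omega
    rw [totalDegree]
    exact (Finset.sup_lt_iff hpos).mpr fun e he => hdeg e he

/-- A nonzero polynomial in a set closed under partial derivatives yields a nonzero constant. -/
theorem exists_C_of_pderiv_closed (P : MvPolynomial (Fin 2) ℂ → Prop)
    (hP : ∀ f i, P f → P (pderiv i f)) {f : MvPolynomial (Fin 2) ℂ} (hf : f ≠ 0) (hPf : P f) :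
    ∃ a : ℂ, a ≠ 0 ∧ P (C a) := by
  induction hN : f.totalDegree using Nat.strong_induction_on generalizing f with
  | _ N ih =>
    by_cases h : ∃ d ∈ f.support, ∃ i, d i ≠ 0
    · obtain ⟨d, hd, i, hi⟩ := h
      obtain ⟨h0, hlt⟩ := totalDegree_pderiv_lt hd hi
      exact ih _ (hN ▸ hlt) h0 (hP f i hPf) rfl
    · push Not at h
      have hC : f = C (coeff 0 f) :=
        totalDegree_eq_zero_iff_eq_C.mp ((totalDegree_eq_zero_iff _ _).mpr h)
      refine ⟨coeff 0 f, fun h0 => hf ?_, hC ▸ hPf⟩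
      rw [hC, h0, C_0]

/-- A family that behaves like a translation covariant, scaling covariant distribution for which
`x₁ - x₂` acts as the invertible `x₀` vanishes as soon as a nonzero polynomial annihilates it. -/
theorem eq_zero_of_polyMulDist_eq_zero {J : ℤ → ℤ → ℤ → E}
    (hJ : ∀ l m n, J (l + 1) m n = J l (m + 1) n - J l m (n + 1)) (S T : Module.End ℂ E) (c : ℂ)
    (hS : ∀ l m n, S (J l m n) = (-(m : ℂ)) • J l (m - 1) n + (-(n : ℂ)) • J l m (n - 1))
    (hT : ∀ l m n, T (J l m n) = (c - l - m - n) • J l m n)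
    {f : MvPolynomial (Fin 2) ℂ} (hf : f ≠ 0)
    (hfJ : ∀ l m n, polyMulDist f (J l) m n = 0) (l m n : ℤ) : J l m n = 0 := by
  have hdiff : ∀ (g : MvPolynomial (Fin 2) ℂ) l m n,
      polyAction (J (l + 1)) m n g =
        polyAction (J l) (m + 1) n g - polyAction (J l) m (n + 1) g := by
    intro g l m n
    induction g using MvPolynomial.induction_on' with
    | monomial d a =>
      simp only [polyAction_monomial]
      rw [hJ, smul_sub, add_right_comm, add_right_comm n]
    | add p q hp hq => simp only [map_add, hp, hq]; abel
  -- Product rule `g ∂J = ∂(gJ) - (∂g)J` with `∂ = ∂₁ + ∂₂`; `hTg` is its analogue for the Euler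
  -- operator.
  have hSg : ∀ (g : MvPolynomial (Fin 2) ℂ) l m n, S (polyAction (J l) m n g) =
      (-(m : ℂ)) • polyAction (J l) (m - 1) n g + (-(n : ℂ)) • polyAction (J l) m (n - 1) g
        - polyAction (J l) m n (pderiv 0 g + pderiv 1 g) := by
    intro g l m n
    induction g using MvPolynomial.induction_on' with
    | monomial d a =>
      have h0 : polyAction (J l) m n (pderiv 0 (monomial d a)) =
          (a * (d 0 : ℕ)) • J l (m - 1 + (d 0 : ℕ)) (n + (d 1 : ℕ)) := by
        rw [pderiv_monomial, polyAction_monomial]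
        -- If `d 0 = 0`, the subtraction in the exponent truncates, but the coefficient vanishes.
        rcases Nat.eq_zero_or_pos (d 0) with h | h
        · simp [h]
        · congr 2
          · simp; omega
          · simp
      have h1 : polyAction (J l) m n (pderiv 1 (monomial d a)) =
          (a * (d 1 : ℕ)) • J l (m + (d 0 : ℕ)) (n - 1 + (d 1 : ℕ)) := by
        rw [pderiv_monomial, polyAction_monomial]
        rcases Nat.eq_zero_or_pos (d 1) with h | h
        · simp [h]
        · congr 2
          · simp
          · simp; omega
      rw [map_add, h0, h1]
      simp only [polyAction_monomial, map_smul, hS]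
      rw [show m + (d 0 : ℕ) - 1 = m - 1 + (d 0 : ℕ) by ring,
        show n + (d 1 : ℕ) - 1 = n - 1 + (d 1 : ℕ) by ring]
      push_cast
      module
    | add p q hp hq => simp only [map_add, hp, hq, smul_add]; abel
  have hTg : ∀ (g : MvPolynomial (Fin 2) ℂ) l m n, T (polyAction (J l) m n g) =
      (c - l - m - n) • polyAction (J l) m n g
        - polyAction (J l) m n (X 0 * pderiv 0 g + X 1 * pderiv 1 g) := by
    intro g l m n
    induction g using MvPolynomial.induction_on' with
    | monomial d a =>
      rw [X_mul_pderiv_monomial, X_mul_pderiv_monomial, map_add, map_nsmul, map_nsmul]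
      simp only [polyAction_monomial, map_smul, hT]
      push_cast
      module
    | add p q hp hq => simp only [map_add, mul_add, hp, hq, smul_add]; abel
  obtain ⟨a, ha, hC⟩ := exists_C_of_pderiv_closed (fun g => ∀ l m n, polyAction (J l) m n g = 0)
    (fun g i hg => by
      have hD : ∀ l m n, polyAction (J l) m n (pderiv 0 g + pderiv 1 g) = 0 := by
        intro l m n
        simpa only [hg, map_zero, smul_zero, add_zero, zero_sub, zero_eq_neg] using hSg g l m n
      have hE : ∀ l m n, polyAction (J l) m n (X 0 * pderiv 0 g + X 1 * pderiv 1 g) = 0 := by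
        intro l m n
        simpa only [hg, map_zero, smul_zero, zero_sub, zero_eq_neg] using hTg g l m n
      have h0 : ∀ l m n, polyAction (J l) m n (pderiv 0 g) = 0 := by
        intro l m n
        have h1 := hE (l - 1) m n
        have h2 := hD (l - 1) m (n + 1)
        rw [map_add, polyAction_X_zero_mul, polyAction_X_one_mul] at h1
        rw [map_add] at h2
        -- `(x₁∂₁ + x₂∂₂)g - x₂(∂₁ + ∂₂)g = (x₁ - x₂)∂₁g`. The relations were taken at `l - 1`, so
        -- the factor `x₁ - x₂` becomes the shift to `l`: this is where invertibility of `x₀`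
        -- enters.
        rw [← sub_add_cancel l 1, hdiff, sub_eq_zero, eq_neg_of_add_eq_zero_left h1,
          eq_neg_of_add_eq_zero_left h2]
      have h1 : ∀ l m n, polyAction (J l) m n (pderiv 1 g) = 0 := by
        intro l m n
        simpa [h0] using hD l m n
      fin_cases i
      · exact h0
      · exact h1)
    hf (fun l m n => by rw [← polyMulDist_eq_polyAction]; exact hfJ l m n)
  have h := hC l m n
  rw [C_apply, polyAction_monomial] at h
  simpa [ha] using h

end PolynomialAction

/-! ### From the quasi-Jacobi identity to the Jacobi identity. -/

section JacobiDefect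

variable {V W : Type*} [AddCommGroup V] [Module ℂ V] [AddCommGroup W] [Module ℂ W]

theorem vmode_add (Y : V →ₗ[ℂ] VertexOperator ℂ W) (u v : V) (n : ℤ) :
    vmode Y (u + v) n = vmode Y u n + vmode Y v n := by
  simp [vmode]

theorem vmode_smul (Y : V →ₗ[ℂ] VertexOperator ℂ W) (c : ℂ) (v : V) (n : ℤ) :
    vmode Y (c • v) n = c • vmode Y v n := by
  simp [vmode]

theorem vmode_zero (Y : V →ₗ[ℂ] VertexOperator ℂ W) (n : ℤ) : vmode Y 0 n = 0 := by
  simp [vmode]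

theorem exists_forall_vmode_eq_zero (Y : V →ₗ[ℂ] VertexOperator ℂ W) (v : V) (w : W) :
    ∃ N : ℤ, ∀ n, N ≤ n → vmode Y v n w = 0 :=
  ⟨-HahnSeries.order ((HahnModule.of ℂ).symm (Y v w)), fun n hn =>
    VertexOperator.ncoeff_eq_zero_of_lt_order _ _ _ (by omega)⟩

/-- The coefficients of `Y(u,x₁) Y(v,x₂) w`. -/
noncomputable def modeProduct (Y : V →ₗ[ℂ] VertexOperator ℂ W) (u v : V) (w : W) (p q : ℤ) : W :=
  vmode Y u p (vmode Y v q w)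

/-- The coefficients of `Y_W(Y(u,x₀)v,x₂) w`. -/
noncomputable def modeIterate (Y : V →ₗ[ℂ] VertexOperator ℂ V) (YW : V →ₗ[ℂ] VertexOperator ℂ W)
    (u v : V) (w : W) (p q : ℤ) : W :=
  vmode YW (vmode Y u p v) q w

theorem exists_modeProduct_eq_zero (Y : V →ₗ[ℂ] VertexOperator ℂ W) (u v : V) (w : W) :
    ∃ N : ℤ, ∀ p q, N ≤ q → modeProduct Y u v w p q = 0 := by
  obtain ⟨N, hN⟩ := exists_forall_vmode_eq_zero Y v w
  exact ⟨N, fun p q hq => by rw [modeProduct, hN q hq, map_zero]⟩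

theorem exists_modeIterate_eq_zero (Y : V →ₗ[ℂ] VertexOperator ℂ V)
    (YW : V →ₗ[ℂ] VertexOperator ℂ W) (u v : V) (w : W) :
    ∃ N : ℤ, ∀ p q, N ≤ p → modeIterate Y YW u v w p q = 0 := by
  obtain ⟨N, hN⟩ := exists_forall_vmode_eq_zero Y u v
  exact ⟨N, fun p q hp => by rw [modeIterate, hN p hp, vmode_zero, LinearMap.zero_apply]⟩

theorem jacobiFirst_eq (Y : V →ₗ[ℂ] VertexOperator ℂ W) (u v : V) (l m n : ℤ) (w : W) :
    jacobiFirst Y u v l m n w = productExpansion (modeProduct Y u v w) l m n := rfl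

theorem jacobiSecond_eq (Y : V →ₗ[ℂ] VertexOperator ℂ W) (u v : V) (l m n : ℤ) (w : W) :
    jacobiSecond Y u v l m n w =
      ((-1 : ℂ) ^ l) • productExpansion (modeProduct Y v u w) l n m := by
  rw [productExpansion, smul_finsum]
  refine finsum_congr fun i => ?_
  rw [smul_smul, mul_assoc]
  rfl

theorem jacobiThird_eq (Y : V →ₗ[ℂ] VertexOperator ℂ V) (YW : V →ₗ[ℂ] VertexOperator ℂ W)
    (u v : V) (l m n : ℤ) (w : W) :
    jacobiThird Y YW u v l m n w = iterateExpansion (modeIterate Y YW u v w) l m n := rfl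

/-- The difference of the two sides of the Jacobi identity. -/
noncomputable def jacobiDefect (Y : V →ₗ[ℂ] VertexOperator ℂ V) (YW : V →ₗ[ℂ] VertexOperator ℂ W)
    (u v : V) (l m n : ℤ) (w : W) : W :=
  jacobiFirst YW u v l m n w - jacobiSecond YW u v l m n w - jacobiThird Y YW u v l m n w

theorem jacobiDefect_succ (Y : V →ₗ[ℂ] VertexOperator ℂ V) (YW : V →ₗ[ℂ] VertexOperator ℂ W)
    (u v : V) (l m n : ℤ) : jacobiDefect Y YW u v (l + 1) m n =
      jacobiDefect Y YW u v l (m + 1) n - jacobiDefect Y YW u v l m (n + 1) := by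
  funext w
  simp only [jacobiDefect, Pi.sub_apply, jacobiFirst_eq, jacobiSecond_eq, jacobiThird_eq,
    productExpansion_succ (exists_modeProduct_eq_zero YW u v w),
    productExpansion_succ (exists_modeProduct_eq_zero YW v u w),
    iterateExpansion_succ (exists_modeIterate_eq_zero Y YW u v w)]
  rw [zpow_add₀ (by norm_num), zpow_one]
  module

/-- The commutator with `T` on functions `W → W`. -/
def bracketFun (T : Module.End ℂ W) : Module.End ℂ (W → W) where
  toFun φ w := T (φ w) - φ (T w)
  map_add' φ ψ := by
    funext w
    simp only [Pi.add_apply, map_add]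
    abel
  map_smul' c φ := by
    funext w
    simp only [Pi.smul_apply, map_smul, smul_sub, RingHom.id_apply]

theorem bracketFun_apply (T : Module.End ℂ W) (φ : W → W) (w : W) :
    bracketFun T φ w = T (φ w) - φ (T w) := rfl

theorem bracket_productExpansion {A B C : ℤ → ℤ → W} (T : Module.End ℂ W)
    (hA : ∃ N : ℤ, ∀ p q, N ≤ q → A p q = 0) (hB : ∃ N : ℤ, ∀ p q, N ≤ q → B p q = 0)
    (h : ∀ p q, T (A p q) = B p q + C p q) (l m n : ℤ) :
    T (productExpansion A l m n) - productExpansion B l m n = productExpansion C l m n := by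
  -- Truncation of `C = T A - B` is inherited from `A` and `B`.
  have hC : ∃ N : ℤ, ∀ p q, N ≤ q → C p q = 0 := by
    obtain ⟨N, hN⟩ := hA
    obtain ⟨K, hK⟩ := hB
    refine ⟨max N K, fun p q hq => ?_⟩
    have := h p q
    rwa [hN p q (le_trans (le_max_left _ _) hq), hK p q (le_trans (le_max_right _ _) hq),
      map_zero, zero_add, eq_comm] at this
  rw [map_productExpansion hA, sub_eq_iff_eq_add', ← productExpansion_add hB hC]
  simp only [h]

theorem bracket_iterateExpansion {A B C : ℤ → ℤ → W} (T : Module.End ℂ W)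
    (hA : ∃ N : ℤ, ∀ p q, N ≤ p → A p q = 0) (hB : ∃ N : ℤ, ∀ p q, N ≤ p → B p q = 0)
    (h : ∀ p q, T (A p q) = B p q + C p q) (l m n : ℤ) :
    T (iterateExpansion A l m n) - iterateExpansion B l m n = iterateExpansion C l m n := by
  have hC : ∃ N : ℤ, ∀ p q, N ≤ p → C p q = 0 := by
    obtain ⟨N, hN⟩ := hA
    obtain ⟨K, hK⟩ := hB
    refine ⟨max N K, fun p q hq => ?_⟩
    have := h p q
    rwa [hN p q (le_trans (le_max_left _ _) hq), hK p q (le_trans (le_max_right _ _) hq),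
      map_zero, zero_add, eq_comm] at this
  rw [map_iterateExpansion hA, sub_eq_iff_eq_add', ← iterateExpansion_add hB hC]
  simp only [h]

/-- Every term of the expansion has the same total index `p + q = l + m + n`. -/
theorem productExpansion_euler (A : ℤ → ℤ → W) (c : ℂ) (l m n : ℤ) :
    productExpansion (fun p q => (c - p - q) • A p q) l m n =
      (c - l - m - n) • productExpansion A l m n := by
  rw [productExpansion, productExpansion, smul_finsum]
  refine finsum_congr fun i => ?_
  rw [smul_smul, smul_smul]
  congr 1
  push_cast
  ring

theorem iterateExpansion_euler (A : ℤ → ℤ → W) (c : ℂ) (l m n : ℤ) :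
    iterateExpansion (fun p q => (c - p - q) • A p q) l m n =
      (c - l - m - n) • iterateExpansion A l m n := by
  rw [iterateExpansion, iterateExpansion, smul_finsum]
  refine finsum_congr fun i => ?_
  rw [smul_smul, smul_smul]
  congr 1
  push_cast
  ring

theorem bracket_neg_apply {L : Sl2Rep V} {LW : Sl2Rep W} {YW : V →ₗ[ℂ] VertexOperator ℂ W}
    (hc : Sl2Compatible L LW YW) (hd : DerivativeProperty L YW) (v : V) (n : ℤ) (w : W) :
    LW.Lneg (vmode YW v n w) = vmode YW v n (LW.Lneg w) + (-(n : ℂ)) • vmode YW v (n - 1) w := by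
  have h := LinearMap.congr_fun (hc.bracket_neg v n) w
  rw [hd v n, Ring.lie_def] at h
  exact sub_eq_iff_eq_add'.mp h

theorem bracket_zero_apply {L : Sl2Rep V} {LW : Sl2Rep W} {YW : V →ₗ[ℂ] VertexOperator ℂ W}
    (hc : Sl2Compatible L LW YW) (hd : DerivativeProperty L YW) {v : V} {c : ℂ}
    (hv : L.Lzero v = c • v) (n : ℤ) (w : W) :
    LW.Lzero (vmode YW v n w) = vmode YW v n (LW.Lzero w) + (c - n - 1) • vmode YW v n w := by
  have h := LinearMap.congr_fun (hc.bracket_zero v n) w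
  rw [hd v (n + 1), hv, vmode_smul, Ring.lie_def, add_sub_cancel_right, ← add_smul] at h
  have h' : LW.Lzero (vmode YW v n w) = vmode YW v n (LW.Lzero w)
      + (-((n + 1 : ℤ) : ℂ) + c) • vmode YW v n w := sub_eq_iff_eq_add'.mp h
  rw [h']
  congr 2
  push_cast
  ring

theorem bracket_neg_jacobiDefect {L : Sl2Rep V} {LW : Sl2Rep W} (Y : V →ₗ[ℂ] VertexOperator ℂ V)
    {YW : V →ₗ[ℂ] VertexOperator ℂ W} (hc : Sl2Compatible L LW YW)
    (hd : DerivativeProperty L YW) (u v : V) (l m n : ℤ) :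
    bracketFun LW.Lneg (jacobiDefect Y YW u v l m n) =
      (-(m : ℂ)) • jacobiDefect Y YW u v l (m - 1) n
        + (-(n : ℂ)) • jacobiDefect Y YW u v l m (n - 1) := by
  funext w
  have hprod : ∀ u v : V, ∀ l m n : ℤ,
      LW.Lneg (productExpansion (modeProduct YW u v w) l m n)
        - productExpansion (modeProduct YW u v (LW.Lneg w)) l m n =
      (-(m : ℂ)) • productExpansion (modeProduct YW u v w) l (m - 1) n
        + (-(n : ℂ)) • productExpansion (modeProduct YW u v w) l m (n - 1) := by
    intro u v l m n
    rw [← productExpansion_deriv (exists_modeProduct_eq_zero YW u v w)]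
    refine bracket_productExpansion _ (exists_modeProduct_eq_zero YW u v w)
      (exists_modeProduct_eq_zero YW u v _) (fun p q => ?_) l m n
    simp only [modeProduct]
    rw [bracket_neg_apply hc hd, bracket_neg_apply hc hd, map_add, map_smul]
    abel
  have hiter : LW.Lneg (iterateExpansion (modeIterate Y YW u v w) l m n)
        - iterateExpansion (modeIterate Y YW u v (LW.Lneg w)) l m n =
      (-(m : ℂ)) • iterateExpansion (modeIterate Y YW u v w) l (m - 1) n
        + (-(n : ℂ)) • iterateExpansion (modeIterate Y YW u v w) l m (n - 1) := by
    rw [← iterateExpansion_deriv (exists_modeIterate_eq_zero Y YW u v w)]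
    refine bracket_iterateExpansion _ (exists_modeIterate_eq_zero Y YW u v w)
      (exists_modeIterate_eq_zero Y YW u v _) (fun p q => ?_) l m n
    simp only [modeIterate]
    rw [bracket_neg_apply hc hd]
  simp only [bracketFun_apply, jacobiDefect, Pi.add_apply, Pi.smul_apply, jacobiFirst_eq,
    jacobiSecond_eq, jacobiThird_eq, map_sub, map_smul]
  linear_combination (norm := module) hprod u v l m n - ((-1 : ℂ) ^ l) • hprod v u l n m - hiter

/-- Each side of the Jacobi identity is homogeneous of the same degree: each of the two modes `u_p`,
`v_q` shifts the `L(0)`-weight by its weight minus its index minus one, whence the `-2`. -/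
theorem bracket_zero_jacobiDefect {L : Sl2Rep V} {LW : Sl2Rep W}
    {Y : V →ₗ[ℂ] VertexOperator ℂ V} {YW : V →ₗ[ℂ] VertexOperator ℂ W}
    (hcV : Sl2Compatible L L Y) (hdV : DerivativeProperty L Y) (hc : Sl2Compatible L LW YW)
    (hd : DerivativeProperty L YW) {u v : V} {a b : ℂ} (hu : L.Lzero u = a • u)
    (hv : L.Lzero v = b • v) (l m n : ℤ) :
    bracketFun LW.Lzero (jacobiDefect Y YW u v l m n) =
      (a + b - 2 - l - m - n) • jacobiDefect Y YW u v l m n := by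
  funext w
  have hprod : ∀ {u v : V} {a b : ℂ}, L.Lzero u = a • u → L.Lzero v = b • v → ∀ l m n : ℤ,
      LW.Lzero (productExpansion (modeProduct YW u v w) l m n)
        - productExpansion (modeProduct YW u v (LW.Lzero w)) l m n =
      (a + b - 2 - l - m - n) • productExpansion (modeProduct YW u v w) l m n := by
    intro u v a b hu hv l m n
    rw [← productExpansion_euler]
    refine bracket_productExpansion _ (exists_modeProduct_eq_zero YW u v w)
      (exists_modeProduct_eq_zero YW u v _) (fun p q => ?_) l m n
    simp only [modeProduct]
    rw [bracket_zero_apply hc hd hu, bracket_zero_apply hc hd hv, map_add, map_smul]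
    module
  have hiter : LW.Lzero (iterateExpansion (modeIterate Y YW u v w) l m n)
        - iterateExpansion (modeIterate Y YW u v (LW.Lzero w)) l m n =
      (a + b - 2 - l - m - n) • iterateExpansion (modeIterate Y YW u v w) l m n := by
    rw [← iterateExpansion_euler]
    refine bracket_iterateExpansion _ (exists_modeIterate_eq_zero Y YW u v w)
      (exists_modeIterate_eq_zero Y YW u v _) (fun p q => ?_) l m n
    have huv : L.Lzero (vmode Y u p v) = (a + b - p - 1) • vmode Y u p v := by
      rw [bracket_zero_apply hcV hdV hu, hv, map_smul]
      module
    simp only [modeIterate]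
    rw [bracket_zero_apply hc hd huv]
    module
  simp only [bracketFun_apply, jacobiDefect, Pi.smul_apply, jacobiFirst_eq,
    jacobiSecond_eq, jacobiThird_eq, map_sub, map_smul]
  linear_combination (norm := module) hprod hu hv l m n - ((-1 : ℂ) ^ l) • hprod hv hu l n m - hiter

theorem jacobiDefect_add_left (Y : V →ₗ[ℂ] VertexOperator ℂ V) (YW : V →ₗ[ℂ] VertexOperator ℂ W)
    (u u' v : V) (l m n : ℤ) (w : W) : jacobiDefect Y YW (u + u') v l m n w =
      jacobiDefect Y YW u v l m n w + jacobiDefect Y YW u' v l m n w := by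
  have h1 : modeProduct YW (u + u') v w =
      fun p q => modeProduct YW u v w p q + modeProduct YW u' v w p q := by
    funext p q
    simp [modeProduct, vmode_add]
  have h2 : modeProduct YW v (u + u') w =
      fun p q => modeProduct YW v u w p q + modeProduct YW v u' w p q := by
    funext p q
    simp [modeProduct, vmode_add]
  have h3 : modeIterate Y YW (u + u') v w =
      fun p q => modeIterate Y YW u v w p q + modeIterate Y YW u' v w p q := by
    funext p q
    simp [modeIterate, vmode_add]
  simp only [jacobiDefect, jacobiFirst_eq, jacobiSecond_eq, jacobiThird_eq]
  rw [h1, h2, h3, productExpansion_add (exists_modeProduct_eq_zero _ _ _ _)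
      (exists_modeProduct_eq_zero _ _ _ _), productExpansion_add (exists_modeProduct_eq_zero _ _ _ _)
      (exists_modeProduct_eq_zero _ _ _ _), iterateExpansion_add (exists_modeIterate_eq_zero _ _ _ _ _)
      (exists_modeIterate_eq_zero _ _ _ _ _)]
  module

theorem jacobiDefect_add_right (Y : V →ₗ[ℂ] VertexOperator ℂ V)
    (YW : V →ₗ[ℂ] VertexOperator ℂ W) (u v v' : V) (l m n : ℤ) (w : W) :
    jacobiDefect Y YW u (v + v') l m n w =
      jacobiDefect Y YW u v l m n w + jacobiDefect Y YW u v' l m n w := by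
  have h1 : modeProduct YW u (v + v') w =
      fun p q => modeProduct YW u v w p q + modeProduct YW u v' w p q := by
    funext p q
    simp [modeProduct, vmode_add]
  have h2 : modeProduct YW (v + v') u w =
      fun p q => modeProduct YW v u w p q + modeProduct YW v' u w p q := by
    funext p q
    simp [modeProduct, vmode_add]
  have h3 : modeIterate Y YW u (v + v') w =
      fun p q => modeIterate Y YW u v w p q + modeIterate Y YW u v' w p q := by
    funext p q
    simp [modeIterate, vmode_add]
  simp only [jacobiDefect, jacobiFirst_eq, jacobiSecond_eq, jacobiThird_eq]
  rw [h1, h2, h3, productExpansion_add (exists_modeProduct_eq_zero _ _ _ _)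
      (exists_modeProduct_eq_zero _ _ _ _), productExpansion_add (exists_modeProduct_eq_zero _ _ _ _)
      (exists_modeProduct_eq_zero _ _ _ _), iterateExpansion_add (exists_modeIterate_eq_zero _ _ _ _ _)
      (exists_modeIterate_eq_zero _ _ _ _ _)]
  module

theorem jacobiDefect_zero_left (Y : V →ₗ[ℂ] VertexOperator ℂ V)
    (YW : V →ₗ[ℂ] VertexOperator ℂ W) (v : V) (l m n : ℤ) (w : W) :
    jacobiDefect Y YW 0 v l m n w = 0 := by
  simpa using jacobiDefect_add_left Y YW 0 0 v l m n w

theorem jacobiDefect_zero_right (Y : V →ₗ[ℂ] VertexOperator ℂ V)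
    (YW : V →ₗ[ℂ] VertexOperator ℂ W) (u : V) (l m n : ℤ) (w : W) :
    jacobiDefect Y YW u 0 l m n w = 0 := by
  simpa using jacobiDefect_add_right Y YW u 0 0 l m n w

theorem polyMulDist_jacobiDefect {Y : V →ₗ[ℂ] VertexOperator ℂ V}
    {YW : V →ₗ[ℂ] VertexOperator ℂ W} {f : MvPolynomial (Fin 2) ℂ} {u v : V}
    (h : QuasiJacobiIdentity Y YW f u v) (l m n : ℤ) :
    polyMulDist f (jacobiDefect Y YW u v l) m n = 0 := by
  funext w
  have := h l m n w
  rw [← sub_eq_zero] at this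
  rw [Pi.zero_apply, ← this]
  simp only [polyMulDist, Finset.sum_apply, Pi.smul_apply, jacobiDefect, smul_sub,
    Finset.sum_sub_distrib]

/-- The Jacobi identity for a module. -/
def ModuleJacobiIdentity (Y : V →ₗ[ℂ] VertexOperator ℂ V) (YW : V →ₗ[ℂ] VertexOperator ℂ W) :
    Prop :=
  ∀ (u v : V) (l m n : ℤ) (w : W),
    jacobiFirst YW u v l m n w - jacobiSecond YW u v l m n w = jacobiThird Y YW u v l m n w

/-- Thanks to the `𝔰𝔩(2)`-action, a quasimodule satisfies the Jacobi identity. -/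
theorem Quasimodule.moduleJacobiIdentity {A : MobiusVertexAlgebra V} (M : Quasimodule A W) :
    ModuleJacobiIdentity A.Y M.YW := by
  have hhom : ∀ i j : ℤ, ∀ u ∈ A.grading i, ∀ v ∈ A.grading j, ∀ l m n w,
      jacobiDefect A.Y M.YW u v l m n w = 0 := by
    intro i j u hu v hv l m n w
    obtain ⟨f, hf, hq⟩ := M.quasi_jacobi u v
    -- The defect is taken with values in `W → W`, all `w` at once, because a commutator also moves
    -- the argument `w`.
    exact congrFun (eq_zero_of_polyMulDist_eq_zero (jacobiDefect_succ A.Y M.YW u v)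
      (bracketFun M.LW.Lneg) (bracketFun M.LW.Lzero) (i + j - 2)
      (bracket_neg_jacobiDefect A.Y M.sl2_compatible M.derivative u v)
      (bracket_zero_jacobiDefect A.sl2_compatible A.derivative M.sl2_compatible M.derivative
        (A.weight i u hu) (A.weight j v hv)) hf (polyMulDist_jacobiDefect hq) l m n) w
  have htop : ∀ x : V, x ∈ ⨆ i, A.grading i := fun x => by
    rw [A.isInternal.submodule_iSup_eq_top]
    trivial
  intro u v l m n w
  rw [← sub_eq_zero]
  change jacobiDefect A.Y M.YW u v l m n w = 0
  induction htop u using Submodule.iSup_induction' with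
  | zero => exact jacobiDefect_zero_left _ _ _ _ _ _ _
  | add x y _ _ hx hy => rw [jacobiDefect_add_left, hx, hy, add_zero]
  | mem i u hu =>
    induction htop v using Submodule.iSup_induction' with
    | zero => exact jacobiDefect_zero_right _ _ _ _ _ _ _
    | add x y _ _ hx hy => rw [jacobiDefect_add_right, hx, hy, add_zero]
    | mem j v hv => exact hhom i j u hu v hv l m n w

end JacobiDefect

/-! ### Raising and lowering the index of cofiniteness. -/

section Cofiniteness

variable {V W : Type*} [AddCommGroup V] [Module ℂ V] [AddCommGroup W] [Module ℂ W]

theorem mem_of_finsum_mem (S : Submodule ℂ W) {x : ℕ → W} (hx : EventuallyZero x) (j : ℕ)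
    (h : ∀ i, i ≠ j → x i ∈ S) (hsum : ∑ᶠ i, x i ∈ S) : x j ∈ S := by
  rw [← Submodule.Quotient.mk_eq_zero, ← Submodule.mkQ_apply] at hsum ⊢
  rw [map_finsum S.mkQ hx.finite_support, finsum_eq_single _ j fun i hi => by
    rw [Submodule.mkQ_apply, Submodule.Quotient.mk_eq_zero]
    exact h i hi] at hsum
  exact hsum

theorem Ring.choose_neg_one (i : ℕ) : Ring.choose (-1 : ℂ) i = (-1) ^ i := by
  induction i with
  | zero => simp
  | succ i ih =>
    have h := Ring.succ_mul_choose_succ (-1) i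
    have hi : (i : ℂ) + 1 ≠ 0 := by exact_mod_cast Nat.succ_ne_zero i
    rw [ih] at h
    apply mul_left_cancel₀ hi
    rw [h]
    ring

/-- The derivative property makes `v_{n-1}` a multiple of `(L(-1)v)_n` whenever `n ≠ 0`, and `k ≥ 1`
keeps `n` negative. -/
theorem vmode_mem_cnSubspace {L : Sl2Rep V} {YW : V →ₗ[ℂ] VertexOperator ℂ W}
    (hd : DerivativeProperty L YW) {k : ℕ} (hk : 1 ≤ k) {n : ℤ} (hn : n ≤ -k) (v : V) (w : W) :
    vmode YW v n w ∈ cnSubspace YW k := by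
  obtain ⟨j, rfl⟩ : ∃ j : ℕ, n = -(k : ℤ) - j := ⟨(-k - n).toNat, by omega⟩
  induction j generalizing v with
  | zero => exact Submodule.subset_span ⟨v, w, by simp⟩
  | succ j ih =>
    have h := ih (L.Lneg v) (by omega)
    rw [hd, LinearMap.smul_apply] at h
    have hne : (-((-(k : ℤ) - j : ℤ) : ℂ)) ≠ 0 := by
      rw [neg_ne_zero, Int.cast_ne_zero]
      omega
    rw [Submodule.smul_mem_iff _ hne] at h
    convert h using 3
    push_cast
    ring

theorem cnSubspace_antitone {L : Sl2Rep V} {YW : V →ₗ[ℂ] VertexOperator ℂ W}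
    (hd : DerivativeProperty L YW) {j k : ℕ} (hj : 1 ≤ j) (hjk : j ≤ k) :
    cnSubspace YW k ≤ cnSubspace YW j := by
  rw [cnSubspace, Submodule.span_le]
  rintro _ ⟨v, w, rfl⟩
  exact vmode_mem_cnSubspace hd hj (by omega) v w

/-- The case `l = 0` of the Jacobi identity, where `(0 choose i)` leaves one term in each product.
-/
theorem vmode_commutator {Y : V →ₗ[ℂ] VertexOperator ℂ V} {YW : V →ₗ[ℂ] VertexOperator ℂ W}
    (hJ : ModuleJacobiIdentity Y YW) (u v : V) (m n : ℤ) (w : W) :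
    vmode YW u m (vmode YW v n w) = vmode YW v n (vmode YW u m w) +
      ∑ᶠ i : ℕ, Ring.choose (m : ℂ) i • vmode YW (vmode Y u i v) (m + n - i) w := by
  have h := hJ u v 0 m n w
  rw [jacobiFirst, jacobiSecond, jacobiThird,
    finsum_eq_single _ 0 fun i hi => by simp [Ring.choose_zero_pos ℂ (Nat.pos_of_ne_zero hi)],
    finsum_eq_single _ 0 fun i hi => by simp [Ring.choose_zero_pos ℂ (Nat.pos_of_ne_zero hi)],
    sub_eq_iff_eq_add'] at h
  simpa using h

/-- The case `m = 0` of the Jacobi identity, where one term is left on the iterate side. -/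
theorem vmode_iterate {Y : V →ₗ[ℂ] VertexOperator ℂ V} {YW : V →ₗ[ℂ] VertexOperator ℂ W}
    (hJ : ModuleJacobiIdentity Y YW) (u v : V) (l n : ℤ) (w : W) :
    vmode YW (vmode Y u l v) n w = jacobiFirst YW u v l 0 n w - jacobiSecond YW u v l 0 n w := by
  rw [hJ, jacobiThird,
    finsum_eq_single _ 0 fun i hi => by simp [Ring.choose_zero_pos ℂ (Nat.pos_of_ne_zero hi)]]
  simp

/-- `C_k(W)` is stable under the modes `u_p` with `p ≤ 0`. -/
theorem vmode_cnSubspace_stable {L : Sl2Rep V} {Y : V →ₗ[ℂ] VertexOperator ℂ V}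
    {YW : V →ₗ[ℂ] VertexOperator ℂ W} (hJ : ModuleJacobiIdentity Y YW)
    (hd : DerivativeProperty L YW) {k : ℕ} (hk : 1 ≤ k) (u : V) {p : ℤ} (hp : p ≤ 0) {w : W}
    (hw : w ∈ cnSubspace YW k) : vmode YW u p w ∈ cnSubspace YW k := by
  induction hw using Submodule.span_induction with
  | mem x hx =>
    obtain ⟨v, w, rfl⟩ := hx
    rw [vmode_commutator hJ]
    refine Submodule.add_mem _ (vmode_mem_cnSubspace hd hk le_rfl _ _)
      (finsum_mem_submodule _ fun i => Submodule.smul_mem _ _ ?_)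
    exact vmode_mem_cnSubspace hd hk (by omega) _ _
  | zero => rw [map_zero]; exact Submodule.zero_mem _
  | add x y _ _ hx hy => rw [map_add]; exact Submodule.add_mem _ hx hy
  | smul c x _ hx => rw [map_smul]; exact Submodule.smul_mem _ _ hx

/-- For `k ≥ 2` the product `u_{-k} v_{-k}` maps `W` into `C_{k+1}(W)`. -/
theorem vmode_vmode_mem_cnSubspace_succ {L : Sl2Rep V} {Y : V →ₗ[ℂ] VertexOperator ℂ V}
    {YW : V →ₗ[ℂ] VertexOperator ℂ W} (hJ : ModuleJacobiIdentity Y YW)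
    (hd : DerivativeProperty L YW) {k : ℕ} (hk : 2 ≤ k) (u v : V) (w : W) :
    vmode YW u (-k) (vmode YW v (-k) w) ∈ cnSubspace YW (k + 1) := by
  have hmem : ∀ {n : ℤ}, n ≤ -((k + 1 : ℕ) : ℤ) → ∀ (v : V) (w : W),
      vmode YW v n w ∈ cnSubspace YW (k + 1) := vmode_mem_cnSubspace hd (by omega)
  -- With `l = -1` and `n = 1 - 2k`, the product expansion is `∑ u_{-1-i} v_{1-2k+i} w`, whose term
  -- `i = k - 1` is the wanted one. The iterate has mode `1 - 2k ≤ -(k+1)` exactly because `k ≥ 2`.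
  have hsecond : jacobiSecond YW u v (-1) 0 (1 - 2 * k) w ∈ cnSubspace YW (k + 1) :=
    finsum_mem_submodule _ fun i => Submodule.smul_mem _ _ (hmem (by push_cast; omega) _ _)
  have hfirst : jacobiFirst YW u v (-1) 0 (1 - 2 * k) w ∈ cnSubspace YW (k + 1) := by
    have h : vmode YW (vmode Y u (-1) v) (1 - 2 * k) w ∈ cnSubspace YW (k + 1) :=
      hmem (by push_cast; omega) _ _
    rw [vmode_iterate hJ] at h
    exact (Submodule.sub_mem_iff_left _ hsecond).mp h
  have hterm := mem_of_finsum_mem _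
    ((eventuallyZero_of_right (exists_modeProduct_eq_zero YW u v w)
      (fun i => 0 + -1 - i) (1 - 2 * k)).smul _) (k - 1) (fun i hi => ?_) hfirst
  · have hunit : (-1 : ℂ) ^ (k - 1) * (-1) ^ (k - 1) = 1 := by
      rw [← mul_pow]
      simp
    have e1 : (0 + -1 - ((k - 1 : ℕ) : ℤ)) = -k := by omega
    have e2 : (1 - 2 * (k : ℤ) + ((k - 1 : ℕ) : ℤ)) = -k := by omega
    simp only [Int.cast_neg, Int.cast_one, Ring.choose_neg_one, hunit, one_smul, e1, e2] at hterm
    exact hterm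
  · refine Submodule.smul_mem _ _ ?_
    -- For `i < k - 1` the inner mode is at most `-(k+1)` and the outer one preserves `C_{k+1}(W)`;
    -- for `i > k - 1` the outer mode is at most `-(k+1)`.
    rcases lt_or_gt_of_ne hi with h | h
    · exact vmode_cnSubspace_stable hJ hd (by omega) _ (by omega)
        (hmem (by push_cast; omega) _ _)
    · exact hmem (by push_cast; omega) _ _

theorem vmode_neg_mem_cnSubspace_succ {L : Sl2Rep V} {Y : V →ₗ[ℂ] VertexOperator ℂ V}
    {YW : V →ₗ[ℂ] VertexOperator ℂ W} (hJ : ModuleJacobiIdentity Y YW)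
    (hd : DerivativeProperty L YW) {k : ℕ} (hk : 2 ≤ k) (v : V) {w : W}
    (hw : w ∈ cnSubspace YW k) : vmode YW v (-k) w ∈ cnSubspace YW (k + 1) := by
  induction hw using Submodule.span_induction with
  | mem x hx =>
    obtain ⟨u, w, rfl⟩ := hx
    exact vmode_vmode_mem_cnSubspace_succ hJ hd hk v u w
  | zero => rw [map_zero]; exact Submodule.zero_mem _
  | add x y _ _ hx hy => rw [map_add]; exact Submodule.add_mem _ hx hy
  | smul c x _ hx => rw [map_smul]; exact Submodule.smul_mem _ _ hx

/-- Expanding `(a_{-k} b)_{-k} w`, every term has outer mode at most `-(k+1)` except `a_{-k} b_{-k}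
w`, which is covered by the product lemma. -/
theorem vmode_neg_mem_cnSubspace_succ_of_mem {L : Sl2Rep V} {Y : V →ₗ[ℂ] VertexOperator ℂ V}
    {YW : V →ₗ[ℂ] VertexOperator ℂ W} (hJ : ModuleJacobiIdentity Y YW)
    (hd : DerivativeProperty L YW) {k : ℕ} (hk : 2 ≤ k) {v : V} (hv : v ∈ cnSubspace Y k)
    (w : W) : vmode YW v (-k) w ∈ cnSubspace YW (k + 1) := by
  have hmem : ∀ {n : ℤ}, n ≤ -((k + 1 : ℕ) : ℤ) → ∀ (v : V) (w : W),
      vmode YW v n w ∈ cnSubspace YW (k + 1) := vmode_mem_cnSubspace hd (by omega)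
  induction hv using Submodule.span_induction with
  | mem x hx =>
    obtain ⟨a, b, rfl⟩ := hx
    rw [vmode_iterate hJ]
    refine Submodule.sub_mem _ (finsum_mem_submodule _ fun i => Submodule.smul_mem _ _ ?_)
      (finsum_mem_submodule _ fun i => Submodule.smul_mem _ _ (hmem (by push_cast; omega) _ _))
    rcases Nat.eq_zero_or_pos i with rfl | hi
    · simpa using vmode_vmode_mem_cnSubspace_succ hJ hd hk a b w
    · exact hmem (by push_cast; omega) _ _
  | zero => rw [vmode_zero, LinearMap.zero_apply]; exact Submodule.zero_mem _
  | add x y _ _ hx hy =>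
    rw [vmode_add, LinearMap.add_apply]
    exact Submodule.add_mem _ hx hy
  | smul c x _ hx =>
    rw [vmode_smul, LinearMap.smul_apply]
    exact Submodule.smul_mem _ _ hx

theorem finiteDimensional_quotient_iff {S : Submodule ℂ W} :
    FiniteDimensional ℂ (W ⧸ S) ↔ ∃ U : Submodule ℂ W, U.FG ∧ U ⊔ S = ⊤ := by
  constructor
  · intro h
    obtain ⟨U, hU⟩ := S.exists_isCompl
    have : Module.Finite ℂ U := Module.Finite.equiv (S.quotientEquivOfIsCompl U hU)
    exact ⟨U, Module.Finite.iff_fg.mp this, hU.symm.sup_eq_top⟩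
  · rintro ⟨U, hU, htop⟩
    have : (⊤ : Submodule ℂ (W ⧸ S)) = U.map S.mkQ := by
      rw [← Submodule.range_mkQ S, ← Submodule.map_top, ← htop, Submodule.map_sup,
        Submodule.mkQ_map_self, sup_bot_eq]
    exact ⟨this ▸ hU.map _⟩

/-- The bilinear map `(v, w) ↦ v_n w`. -/
noncomputable def vmodeBilin (YW : V →ₗ[ℂ] VertexOperator ℂ W) (n : ℤ) : V →ₗ[ℂ] W →ₗ[ℂ] W where
  toFun v := vmode YW v n
  map_add' u v := vmode_add YW u v n
  map_smul' c v := vmode_smul YW c v n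

theorem cofinite_succ {L : Sl2Rep V} {Y : V →ₗ[ℂ] VertexOperator ℂ V}
    {YW : V →ₗ[ℂ] VertexOperator ℂ W} (hJ : ModuleJacobiIdentity Y YW)
    (hd : DerivativeProperty L YW) {k : ℕ} (hk : 2 ≤ k)
    (hV : FiniteDimensional ℂ (V ⧸ cnSubspace Y k))
    (hW : FiniteDimensional ℂ (W ⧸ cnSubspace YW k)) :
    FiniteDimensional ℂ (W ⧸ cnSubspace YW (k + 1)) := by
  rw [finiteDimensional_quotient_iff] at hV hW ⊢
  obtain ⟨T, hT, hTtop⟩ := hV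
  obtain ⟨U, hU, hUtop⟩ := hW
  -- `U` spans `W` modulo `C_k(W)`, and the vectors `t_{-k} u` span `C_k(W)` modulo `C_{k+1}(W)`.
  set F := U ⊔ Submodule.map₂ (vmodeBilin YW (-k)) T U with hF
  refine ⟨F, hU.sup (hT.map₂ _ hU), top_unique ?_⟩
  have hle : cnSubspace YW k ≤ F ⊔ cnSubspace YW (k + 1) := by
    rw [cnSubspace, Submodule.span_le]
    rintro _ ⟨v, w, rfl⟩
    obtain ⟨u, hu, w', hw', rfl⟩ := Submodule.mem_sup.mp (hUtop ▸ Submodule.mem_top : w ∈ U ⊔ _)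
    obtain ⟨t, ht, v', hv', rfl⟩ := Submodule.mem_sup.mp (hTtop ▸ Submodule.mem_top : v ∈ T ⊔ _)
    rw [map_add]
    refine Submodule.add_mem _ ?_ (Submodule.mem_sup_right
      (vmode_neg_mem_cnSubspace_succ hJ hd hk _ hw'))
    rw [vmode_add, LinearMap.add_apply]
    exact Submodule.add_mem _
      (Submodule.mem_sup_left (Submodule.mem_sup_right (Submodule.apply_mem_map₂ _ ht hu)))
      (Submodule.mem_sup_right (vmode_neg_mem_cnSubspace_succ_of_mem hJ hd hk hv' u))
  rw [← hUtop]
  exact sup_le (le_sup_left.trans le_sup_left) hle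

theorem finiteDimensional_quotient_of_le {S T : Submodule ℂ W} (h : S ≤ T)
    (hS : FiniteDimensional ℂ (W ⧸ S)) : FiniteDimensional ℂ (W ⧸ T) := by
  rw [finiteDimensional_quotient_iff] at hS ⊢
  obtain ⟨U, hU, htop⟩ := hS
  exact ⟨U, hU, top_unique (htop ▸ sup_le_sup_left h U)⟩

theorem MobiusVertexAlgebra.isCnCofinite_of_two {A : MobiusVertexAlgebra V}
    (h : A.IsCnCofinite 2) {n : ℕ} (hn : 2 ≤ n) : A.IsCnCofinite n := by
  induction n, hn using Nat.le_induction with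
  | base => exact h
  -- `V` is a module over itself, so the induction hypothesis supplies both finiteness inputs.
  | succ k hk ih => exact cofinite_succ A.jacobi A.derivative hk ih ih

end Cofiniteness

theorem mainTheorem5 {V : Type*} [AddCommGroup V] [Module ℂ V] {W : Type*} [AddCommGroup W]
    [Module ℂ W] (A : MobiusVertexAlgebra V) (hgraded : A.IsNGraded) (hcofinite : A.IsCnCofinite 2)
    (M : Quasimodule A W) (n : ℕ) (hn : 2 ≤ n) :
    M.IsCnCofinite 2 ↔ M.IsCnCofinite n := by
  constructor
  · intro h
    induction n, hn using Nat.le_induction with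
    | base => exact h
    | succ k hk ih =>
      exact cofinite_succ M.moduleJacobiIdentity M.derivative hk
        (A.isCnCofinite_of_two hcofinite hk) ih
  · exact finiteDimensional_quotient_of_le
      (cnSubspace_antitone M.derivative (by omega) hn)
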